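/- **Setting.** Let $X=\{0,\dots,d-1\}$ and let $X^*$ be the $d$-ary rooted tree of finite words over $X$. Automorphisms of $X^*$ act on the right: in a product $gh$ the automorphism $g$ is applied first, $(gh)(v)=h(g(v))$. The section $g|_v$ of $g\in\operatorname{Aut}X^*$ at $v\in X^*$ is the automorphism defined by $g(vw)=g(v)\,g|_v(w)$ for all $w\in X^*$. A group $G\le\operatorname{Aut}X^*$ is *self-similar* if $g|_v\in G$ for all $g\in G$ and $v\in X^*$. A self-similar group $G$ is *contracting* if there is a finite set $\mathcal N\subseteq G$ such that for every $g\in G$ there is $l\ge 0$ with $g|_v\in\mathcal N$ for all words $v$ of length at least $l$; the least such set is the *nucleus* of $G$. Let $\Psi(g)=(g|_0,\dots,g|_{d-1})$ for $g$ in the stabilizer $\mathrm{St}_G(1)$ of the first level. The group $G$ is *regular branch* if it acts transitively on every level $X^k$ of the tree and has a nontrivial subgroup $K$ with $[G:K]<\infty$, such that $K\times\dots\times K$ ($d$ factors) is contained in $\Psi(\mathrm{St}_G(1)\cap K)$ as a subgroup of finite index. The *nucleus portrait* of an element $g$ of a contracting group with nucleus $\mathcal N$ is the following finite labelled tree: if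 $g\in\mathcal N$, it is a single vertex labelled by $g$; otherwise its root is labelled by the permutation of $X$ induced by $g$ on the first level, and the root is connected to $d$ children, which are the roots of the nucleus portraits of $g|_0,\dots,g|_{d-1}$. **Theorem.** Let $G$ be a contracting self-similar regular branch group generated by a finite set $S$ that contains the nucleus of $G$. Then there are a (multi-stack) Turing machine $M$ and a polynomial $p$, depending only on $G$ and $S$, with the following property. For every $g\in G$, given the nucleus portrait of $g$ as input (written as the list of its labels in preorder), $M$ halts and outputs a word $w$ in $S^{\pm1}$ that represents $g$; and if $g$ is represented by some word in $S^{\pm1}$ of length $n$, then $M$ halts within $p(n)$ steps and $w$ has length at most $p(n)$. -/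

import Mathlib

/-- An automorphism of the regular rooted tree `X^*`, `X = {0, …, d-1}`: a bijection of the set of
finite words over `X` that preserves the levels and the ancestor (prefix) relation. -/
@[ext]
structure TreeAut (d : ℕ) where
  toPerm : Equiv.Perm (List (Fin d))
  length_map : ∀ v, (toPerm v).length = v.length
  prefix_map : ∀ v w, v <+: w → toPerm v <+: toPerm w

namespace TreeAut

variable {d : ℕ}

instance : CoeFun (TreeAut d) (fun _ => List (Fin d) → List (Fin d)) := ⟨fun g => g.toPerm⟩

theorem ext_apply {g h : TreeAut d} (H : ∀ v, g v = h v) : g = h :=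
  TreeAut.ext (Equiv.ext H)

/-- The inverse automorphism. -/
def inverse (g : TreeAut d) : TreeAut d where
  toPerm := g.toPerm.symm
  length_map v := by
    have := g.length_map (g.toPerm.symm v)
    simpa using this.symm
  prefix_map v w hvw := by
    have hw : g.toPerm ((g.toPerm.symm w).take v.length) <+: w := by
      have := g.prefix_map _ _ (List.take_prefix v.length (g.toPerm.symm w))
      simpa using this
    have hlen : (g.toPerm.symm w).length = w.length := by
      have := g.length_map (g.toPerm.symm w)
      simpa using this.symm
    have hl : (g.toPerm ((g.toPerm.symm w).take v.length)).length = v.length := by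
      rw [g.length_map, List.length_take, hlen]
      exact min_eq_left hvw.length_le
    have he : g.toPerm ((g.toPerm.symm w).take v.length) = v :=
      (List.prefix_of_prefix_length_le hw hvw hl.le).eq_of_length hl
    have he' : g.toPerm.symm v = (g.toPerm.symm w).take v.length := by
      rw [Equiv.symm_apply_eq, he]
    rw [he']
    exact List.take_prefix _ _

/-- The group of automorphisms of the tree. Groups act on the right: in a product `g * h`
the automorphism `g` is applied first, `(g * h) v = h (g v)`. -/
instance : Group (TreeAut d) where
  mul g h :=
    { toPerm := g.toPerm.trans h.toPerm
      length_map := fun v => by simp [g.length_map, h.length_map]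
      prefix_map := fun v w hvw => h.prefix_map _ _ (g.prefix_map _ _ hvw) }
  one :=
    { toPerm := Equiv.refl _
      length_map := fun _ => rfl
      prefix_map := fun _ _ h => h }
  inv := inverse
  mul_assoc _ _ _ := rfl
  one_mul _ := rfl
  mul_one _ := rfl
  inv_mul_cancel g := ext_apply fun v => g.toPerm.apply_symm_apply v

theorem mul_apply (g h : TreeAut d) (v : List (Fin d)) : (g * h) v = h (g v) := rfl

theorem one_apply (v : List (Fin d)) : (1 : TreeAut d) v = v := rfl

theorem inv_apply (g : TreeAut d) (v : List (Fin d)) : (g⁻¹) v = g.toPerm.symm v := rfl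

theorem apply_append_drop (g : TreeAut d) (v w : List (Fin d)) :
    g (v ++ w) = g v ++ (g (v ++ w)).drop v.length := by
  obtain ⟨t, ht⟩ := g.prefix_map v (v ++ w) (List.prefix_append v w)
  rw [← ht, ← g.length_map v, List.drop_left]

/-- The section `g|_v` of `g` at the vertex `v`: it is determined by `g (v w) = g(v) (g|_v)(w)`. -/
def sectionAt (g : TreeAut d) (v : List (Fin d)) : TreeAut d where
  toPerm :=
    { toFun := fun w => (g (v ++ w)).drop v.length
      invFun := fun w => ((g⁻¹) (g v ++ w)).drop v.length
      left_inv := fun w => by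
        beta_reduce
        rw [← apply_append_drop, inv_apply, Equiv.symm_apply_apply, List.drop_left]
      right_inv := fun w => by
        have h := apply_append_drop (g⁻¹) (g v) w
        have h1 : (g⁻¹) (g v) = v := g.toPerm.symm_apply_apply v
        rw [h1, g.length_map] at h
        have h2 : g (v ++ ((g⁻¹) (g v ++ w)).drop v.length) = g v ++ w := by
          rw [← h]; exact g.toPerm.apply_symm_apply _
        beta_reduce
        rw [h2, ← g.length_map v, List.drop_left] }
  length_map w := by simp [g.length_map]
  prefix_map w w' h := by
    have h' := g.prefix_map _ _ ((List.prefix_append_right_inj v).2 h)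
    rw [apply_append_drop g v w, apply_append_drop g v w', List.prefix_append_right_inj] at h'
    exact h'

theorem apply_append (g : TreeAut d) (v w : List (Fin d)) :
    g (v ++ w) = g v ++ g.sectionAt v w :=
  apply_append_drop g v w

theorem section_nil (g : TreeAut d) : g.sectionAt [] = g :=
  ext_apply fun _ => rfl

theorem section_append (g : TreeAut d) (v w : List (Fin d)) :
    g.sectionAt (v ++ w) = (g.sectionAt v).sectionAt w := by
  refine ext_apply fun u => ?_
  have h := g.apply_append (v ++ w) u
  rw [List.append_assoc, g.apply_append v (w ++ u), g.apply_append v w,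
    (g.sectionAt v).apply_append w u, ← List.append_assoc] at h
  exact (List.append_cancel_left h).symm

theorem section_mul (g h : TreeAut d) (v : List (Fin d)) :
    (g * h).sectionAt v = g.sectionAt v * h.sectionAt (g v) := by
  refine ext_apply fun u => ?_
  have e := (g * h).apply_append v u
  rw [mul_apply, mul_apply, g.apply_append v u, h.apply_append] at e
  exact (List.append_cancel_left e).symm

theorem section_one (v : List (Fin d)) : (1 : TreeAut d).sectionAt v = 1 := by
  refine ext_apply fun u => ?_
  have e := (1 : TreeAut d).apply_append v u
  rw [one_apply, one_apply] at e
  exact (List.append_cancel_left e).symm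

end TreeAut

namespace SelfSimilar

variable {d : ℕ}

/-- A set of tree automorphisms is self-similar if it contains all sections of its elements. -/
def IsSelfSimilar (S : Set (TreeAut d)) : Prop :=
  ∀ g ∈ S, ∀ v, g.sectionAt v ∈ S

/-- `G` acts transitively on the levels of the tree. -/
def IsLevelTransitive (G : Subgroup (TreeAut d)) : Prop :=
  ∀ v w : List (Fin d), v.length = w.length → ∃ g ∈ G, g v = w

/-- The stabilizer of the first level in the full automorphism group. -/
def firstLevelStabilizer (d : ℕ) : Subgroup (TreeAut d) where
  carrier := {g | ∀ x : Fin d, g [x] = [x]}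
  mul_mem' {g h} hg hh x := by rw [TreeAut.mul_apply, hg x, hh x]
  one_mem' _ := rfl
  inv_mem' {g} hg x := by
    rw [TreeAut.inv_apply, Equiv.symm_apply_eq]; exact (hg x).symm

/-- The embedding `Ψ : g ↦ (g|_0, …, g|_{d-1})` of the first level stabilizer. -/
def sections (d : ℕ) : firstLevelStabilizer d →* (Fin d → TreeAut d) where
  toFun g x := g.1.sectionAt [x]
  map_one' := funext fun x => TreeAut.section_one [x]
  map_mul' g h := funext fun x => by
    have e := TreeAut.section_mul g.1 h.1 [x]
    rw [g.2 x] at e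
    exact e

/-- The subgroup `Ψ(St_G(1) ∩ K)` for a subgroup `K` of `G`. -/
def sectionsImage (K : Subgroup (TreeAut d)) : Subgroup (Fin d → TreeAut d) :=
  (K.subgroupOf (firstLevelStabilizer d)).map (sections d)

/-- The direct power `K × ⋯ × K` (`d` factors). -/
def directPower (K : Subgroup (TreeAut d)) : Subgroup (Fin d → TreeAut d) :=
  Subgroup.pi Set.univ fun _ => K

/-- `G` is a regular branch group over `K`. -/
structure IsRegularBranchOver (G K : Subgroup (TreeAut d)) : Prop where
  level_transitive : IsLevelTransitive G
  le : K ≤ G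
  nontrivial : K ≠ ⊥
  geometrically_contains : directPower K ≤ sectionsImage K
  finite_index : K.relIndex G ≠ 0
  finite_index_power : (directPower K).relIndex (sectionsImage K) ≠ 0

/-- `G` is a regular branch group. -/
def IsRegularBranch (G : Subgroup (TreeAut d)) : Prop :=
  ∃ K, IsRegularBranchOver G K

/-- `N` is a finite subset of `G` to which all elements of `G` contract. -/
structure IsContractingSet (G : Subgroup (TreeAut d)) (N : Set (TreeAut d)) : Prop where
  finite : N.Finite
  subset : N ⊆ G
  contracts : ∀ g ∈ G, ∃ l : ℕ, ∀ k ≥ l, ∀ v : List (Fin d), v.length = k → g.sectionAt v ∈ N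

/-- A (self-similar) group is contracting if such a finite set exists. -/
def IsContracting (G : Subgroup (TreeAut d)) : Prop :=
  ∃ N, IsContractingSet G N

/-- The nucleus: the least finite set to which all elements contract. -/
def nucleus (G : Subgroup (TreeAut d)) : Set (TreeAut d) :=
  ⋂₀ {N | IsContractingSet G N}

theorem IsContractingSet.inter {G : Subgroup (TreeAut d)} {N M : Set (TreeAut d)}
    (hN : IsContractingSet G N) (hM : IsContractingSet G M) : IsContractingSet G (N ∩ M) where
  finite := hN.finite.subset Set.inter_subset_left
  subset := Set.inter_subset_left.trans hN.subset
  contracts g hg := by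
    obtain ⟨l, hl⟩ := hN.contracts g hg
    obtain ⟨m, hm⟩ := hM.contracts g hg
    exact ⟨max l m, fun k hk v hv =>
      ⟨hl k (le_trans (le_max_left _ _) hk) v hv, hm k (le_trans (le_max_right _ _) hk) v hv⟩⟩

/-- In a contracting group the nucleus is the least set to which all elements contract. -/
theorem isLeast_nucleus {G : Subgroup (TreeAut d)} (hG : IsContracting G) :
    IsLeast {N | IsContractingSet G N} (nucleus G) := by
  refine ⟨?_, fun N hN => Set.sInter_subset_of_mem hN⟩
  obtain ⟨M, hM, hmin⟩ := exists_minimalFor_of_wellFoundedLT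
    (fun N => IsContractingSet G N) Set.ncard hG
  have hle : ∀ N, IsContractingSet G N → M ⊆ N := fun N hN => by
    have h1 := hmin (hM.inter hN) (Set.ncard_le_ncard Set.inter_subset_left hM.finite)
    have h2 := Set.eq_of_subset_of_ncard_le (Set.inter_subset_left (s := M) (t := N)) h1 hM.finite
    exact h2 ▸ Set.inter_subset_right
  have : nucleus G = M :=
    Set.Subset.antisymm (Set.sInter_subset_of_mem hM) (Set.subset_sInter hle)
  rw [this]
  exact hM

/-- Finite `d`-ary trees with inner vertices labelled by permutations of `X = {0, …, d-1}` and
leaves labelled by elements of `N`. -/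
inductive Portrait (d : ℕ) (N : Type) : Type where
  | leaf : N → Portrait d N
  | node : Equiv.Perm (Fin d) → (Fin d → Portrait d N) → Portrait d N

/-- The alphabet in which portraits are written. -/
abbrev PortraitSymbol (d : ℕ) (N : Type) : Type := Equiv.Perm (Fin d) ⊕ N

/-- A portrait written as a word: the list of its labels in preorder (the label of the root,
followed by the codes of the subtrees at the children `0, …, d-1`). -/
def Portrait.encode {N : Type} : Portrait d N → List (PortraitSymbol d N)
  | .leaf n => [Sum.inr n]
  | .node σ c => Sum.inl σ :: (List.ofFn fun x => (c x).encode).flatten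

/-- `IsNucleusPortrait G g P`: the labelled tree `P` is the nucleus portrait of `g`. It is a single
leaf labelled by `g` if `g` is in the nucleus; otherwise its root is labelled by the permutation
that `g` induces on the first level, and the child `x` is the root of the portrait of `g|_x`. -/
inductive IsNucleusPortrait (G : Subgroup (TreeAut d)) :
    TreeAut d → Portrait d (nucleus G) → Prop where
  | leaf (g : TreeAut d) (hg : g ∈ nucleus G) : IsNucleusPortrait G g (.leaf ⟨g, hg⟩)
  | node (g : TreeAut d) (hg : g ∉ nucleus G) (σ : Equiv.Perm (Fin d))
      (hσ : ∀ x, g [x] = [σ x]) (c : Fin d → Portrait d (nucleus G))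
      (hc : ∀ x, IsNucleusPortrait G (g.sectionAt [x]) (c x)) :
      IsNucleusPortrait G g (.node σ c)

theorem exists_rootPerm (g : TreeAut d) : ∃ σ : Equiv.Perm (Fin d), ∀ x, g [x] = [σ x] := by
  have h : ∀ g : TreeAut d, ∀ x : Fin d, ∃ y, g [x] = [y] := fun g x =>
    List.length_eq_one_iff.1 (g.length_map [x])
  choose f hf using h
  have key : ∀ (g h : TreeAut d), g * h = 1 → ∀ x, f h (f g x) = x := fun g h e x => by
    have := TreeAut.mul_apply g h [x]
    rw [e, TreeAut.one_apply, hf, hf] at this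
    simpa using this.symm
  exact ⟨⟨f g, f g⁻¹, key g g⁻¹ (mul_inv_cancel g), key g⁻¹ g (inv_mul_cancel g)⟩, hf g⟩

/-- Every element of a contracting group has a unique nucleus portrait. -/
theorem existsUnique_nucleusPortrait {G : Subgroup (TreeAut d)} (hG : IsContracting G)
    {g : TreeAut d} (hg : g ∈ G) : ∃! P, IsNucleusPortrait G g P := by
  obtain ⟨l, hl⟩ := (isLeast_nucleus hG).1.contracts g hg
  clear hg
  refine existsUnique_of_exists_of_unique ?_ ?_
  · induction l generalizing g with
    | zero =>
      have := hl 0 le_rfl [] rfl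
      rw [TreeAut.section_nil] at this
      exact ⟨_, .leaf g this⟩
    | succ l ih =>
      by_cases hgN : g ∈ nucleus G
      · exact ⟨_, .leaf g hgN⟩
      obtain ⟨σ, hσ⟩ := exists_rootPerm g
      have hsec : ∀ x : Fin d, ∃ P, IsNucleusPortrait G (g.sectionAt [x]) P := fun x =>
        ih fun k hk v hv => by
          rw [← TreeAut.section_append]
          exact hl (k + 1) (by omega) _ (by simp [hv])
      choose c hc using hsec
      exact ⟨_, .node g hgN σ hσ c hc⟩
  · intro P Q hP hQ
    clear hl
    induction hP generalizing Q with
    | leaf g hg =>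
      cases hQ with
      | leaf => rfl
      | node _ hg' => exact absurd hg hg'
    | node g hg σ hσ c hc ih =>
      cases hQ with
      | leaf _ hg' => exact absurd hg' hg
      | node _ _ τ hτ c' hc' =>
        have e1 : σ = τ := Equiv.ext fun x => by simpa using (hσ x).symm.trans (hτ x)
        have e2 : c = c' := funext fun x => ih x _ (hc' x)
        rw [e1, e2]

/-- The nucleus portrait of an element of a contracting group. -/
noncomputable def nucleusPortrait {G : Subgroup (TreeAut d)} (hG : IsContracting G) (g : G) :
    Portrait d (nucleus G) :=
  (existsUnique_nucleusPortrait hG g.2).choose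

theorem nucleusPortrait_spec {G : Subgroup (TreeAut d)} (hG : IsContracting G) (g : G) :
    IsNucleusPortrait G g.1 (nucleusPortrait hG g) :=
  (existsUnique_nucleusPortrait hG g.2).choose_spec.1

/-- Words in the letters `s` and `s⁻¹`, `s ∈ S`: the pair `(s, true)` stands for `s` and
`(s, false)` for `s⁻¹`. -/
abbrev GenWord (S : Set (TreeAut d)) : Type := List (S × Bool)

/-- The tree automorphism that a word represents. -/
def GenWord.eval {S : Set (TreeAut d)} (w : GenWord S) : TreeAut d :=
  (w.map fun a => if a.2 then (a.1 : TreeAut d) else (a.1 : TreeAut d)⁻¹).prod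

end SelfSimilar

/-! Let `K` be a branching subgroup. It has finite index in a finitely generated group, so it has a
finite generating set `A`, and every `g` in `G` is `k * rep t` with `k` in `K` and `t` from a finite
set `T`. Thus `g` is encoded by a word over `A` and an element of `T`, and the portrait is evaluated
from the leaves upwards in this encoding. At an inner vertex let the sections be `eval w_x * rep
t_x`. Since `K × ⋯ × K` lies in the image of `K ∩ St(1)`, every letter `b` at a child `x` can be
replaced by a fixed word over `A` for an element of `K` with section `b` at `x` and trivial sections
elsewhere. The concatenation of the substituted words is some `h` in `K` with sections `eval w_x`.
Then `h⁻¹ * g` has the root permutation of `g` and sections `rep t_x`, so only finitely many such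
quotients occur and a finite table lists them (`exists_isCompatible`, `IsCompatible.eval_value`).
Each level multiplies lengths and running times by at most a constant (`exists_size_bound`,
`IsNucleusPortrait.le_pow`). Contraction halves the number of factors of a product every boundedly
many levels, so the portrait of an element of length `n` has depth `O(log n)`
(`exists_logarithmic_level`), and an exponential of this depth is polynomial in `n`. -/

open Turing SelfSimilar

/-! ### Evaluation of portraits and the program of the machine -/

/-- The data of a bottom-up evaluation of portraits. A portrait has a value in `List B × T`; the
value at an inner vertex is obtained from the values at its children by substituting words for
letters, concatenating, and looking up a word and an element of `T` in a finite table. Finally the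
value is turned into a word over `O`, letter by letter. -/
structure PortraitEvaluator (d : ℕ) (N B T O : Type) where
  leafWord : N → List B
  leafRep : N → T
  subst : Fin d → B → List B
  nodeWord : Equiv.Perm (Fin d) → (Fin d → T) → List B
  nodeRep : Equiv.Perm (Fin d) → (Fin d → T) → T
  outLetter : B → List O
  outRep : T → List O

namespace PortraitEvaluator

variable {d : ℕ} {N B T O : Type} (E : PortraitEvaluator d N B T O)

/-- The value of a portrait. -/
def value : Portrait d N → List B × T
  | .leaf n => (E.leafWord n, E.leafRep n)
  | .node σ c =>
    ((List.ofFn fun x => (value (c x)).1.flatMap (E.subst x)).flatten ++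
      E.nodeWord σ (fun x => (value (c x)).2), E.nodeRep σ fun x => (value (c x)).2)

/-- The output word of a portrait. -/
def output (P : Portrait d N) : List O :=
  (E.value P).1.flatMap E.outLetter ++ E.outRep (E.value P).2

/-- The five stacks of the machine. -/
inductive Stack
  | input | reversed | main | aux | output
  deriving DecidableEq

instance : Fintype Stack :=
  ⟨{.input, .reversed, .main, .aux, .output}, fun k => by cases k <;> decide⟩

/-- The stack alphabets. -/
abbrev Alphabet (d : ℕ) (N B T O : Type) : Stack → Type
  | .input => PortraitSymbol d N
  | .reversed => PortraitSymbol d N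
  | .main => B ⊕ T
  | .aux => B
  | .output => O

/-- The function labels of the machine. A label `fooAct s` is visited after the label `foo` has
popped the symbol `s`. -/
inductive Label (d : ℕ) (N B T : Type)
  | reverse
  | reverseAct (s : PortraitSymbol d N)
  | read
  | readAct (s : PortraitSymbol d N)
  | combine (σ : Equiv.Perm (Fin d)) (i : Fin (d + 1)) (ts : Fin d → T)
  | combineAct (σ : Equiv.Perm (Fin d)) (i : Fin d) (ts : Fin d → T) (s : B ⊕ T)
  | restore
  | restoreAct (b : B)
  | finish
  | finishAct (s : B ⊕ T)
  | emit
  | emitAct (b : B)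

/-- The register of the machine: the symbol popped last. -/
abbrev Register (d : ℕ) (N B T : Type) : Type := Option (PortraitSymbol d N ⊕ (B ⊕ T))

instance [Finite N] [Finite B] [Finite T] : Finite (Label d N B T) := by
  let f : Label d N B T → Fin 12 × Option (PortraitSymbol d N) × Option (B ⊕ T) ×
      Option (Equiv.Perm (Fin d) × Fin (d + 1) × (Fin d → T)) := fun
    | .reverse => (0, none, none, none)
    | .reverseAct s => (1, some s, none, none)
    | .read => (2, none, none, none)
    | .readAct s => (3, some s, none, none)
    | .combine σ i ts => (4, none, none, some (σ, i, ts))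
    | .combineAct σ i ts s => (5, none, some s, some (σ, i.castSucc, ts))
    | .restore => (6, none, none, none)
    | .restoreAct b => (7, none, some (.inl b), none)
    | .finish => (8, none, none, none)
    | .finishAct s => (9, none, some s, none)
    | .emit => (10, none, none, none)
    | .emitAct b => (11, none, some (.inl b), none)
  refine Finite.of_injective f fun a b h => ?_
  cases a <;> cases b <;> simp_all [f]

/-- The statements of the machine. -/
abbrev Program (d : ℕ) (N B T O : Type) : Type :=
  TM2.Stmt (Alphabet d N B T O) (Label d N B T) (Register d N B T)

/-- Push a fixed list, so that its head becomes the top of the stack. -/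
def pushList (k : Stack) (l : List (Alphabet d N B T O k)) (q : Program d N B T O) :
    Program d N B T O :=
  l.foldl (fun q a => .push k (fun _ => a) q) q

/-- The program of the machine. -/
def program [Inhabited T] : Label d N B T → Program d N B T O
  | .reverse => .pop .input (fun _ a => a.map .inl) <| .goto fun
    | some (.inl s) => .reverseAct s
    | _ => .read
  | .reverseAct s => .load (fun _ => none) <| pushList .reversed [s] <| .goto fun _ => .reverse
  | .read => .pop .reversed (fun _ a => a.map .inl) <| .goto fun
    | some (.inl s) => .readAct s
    | _ => .finish
  | .readAct (.inr n) => .load (fun _ => none) <|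
      pushList .main ((E.leafWord n).map .inl ++ [.inr (E.leafRep n)]) <| .goto fun _ => .read
  -- The entries `default` are placeholders: each one is overwritten before `i` reaches `d`, where
  -- the tuple is used.
  | .readAct (.inl σ) => .load (fun _ => none) <| .goto fun _ => .combine σ 0 fun _ => default
  | .combine σ i ts =>
    if h : i.1 < d then
      .pop .main (fun _ a => a.map .inr) <| .goto fun
        | some (.inr s) => .combineAct σ ⟨i, h⟩ ts s
        | _ => .read
    else
      pushList .main ((E.nodeWord σ ts).map .inl ++ [.inr (E.nodeRep σ ts)]) <|
        .goto fun _ => .restore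
  -- The auxiliary stack collects the new word in reversed order; `restore` reverses it again while
  -- moving it back to the main stack.
  | .combineAct σ i ts (.inl b) => .load (fun _ => none) <|
      pushList .aux (E.subst i b).reverse <| .goto fun _ => .combine σ i.castSucc ts
  | .combineAct σ i ts (.inr t) => .load (fun _ => none) <|
      .goto fun _ => .combine σ i.succ (Function.update ts i t)
  | .restore => .pop .aux (fun _ a => a.map fun b => .inr (.inl b)) <| .goto fun
    | some (.inr (.inl b)) => .restoreAct b
    | _ => .read
  | .restoreAct b => .load (fun _ => none) <| pushList .main [.inl b] <| .goto fun _ => .restore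
  | .finish => .pop .main (fun _ a => a.map .inr) <| .goto fun
    | some (.inr s) => .finishAct s
    | _ => .emit
  -- The output stack is built from its bottom, so the output is produced from its end: the
  -- representative comes first, then the letters, which leave the auxiliary stack in reversed
  -- order.
  | .finishAct (.inl b) => .load (fun _ => none) <| pushList .aux [b] <| .goto fun _ => .finish
  | .finishAct (.inr t) => .load (fun _ => none) <|
      pushList .output (E.outRep t) <| .goto fun _ => .emit
  | .emit => .pop .aux (fun _ a => a.map fun b => .inr (.inl b)) <| .branch Option.isNone .halt <|
      .goto fun
    | some (.inr (.inl b)) => .emitAct b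
    | _ => .emit
  | .emitAct b => .load (fun _ => none) <|
      pushList .output (E.outLetter b) <| .goto fun _ => .emit

/-- The contents of the five stacks. -/
def contents (i r : List (PortraitSymbol d N)) (m : List (B ⊕ T)) (a : List B) (o : List O) :
    ∀ k, List (Alphabet d N B T O k)
  | .input => i
  | .reversed => r
  | .main => m
  | .aux => a
  | .output => o

section Stacks

variable (i r : List (PortraitSymbol d N)) (m : List (B ⊕ T)) (a : List B) (o : List O)

@[simp]
theorem update_contents_input (l : List (PortraitSymbol d N)) :
    Function.update (contents i r m a o) .input l = contents l r m a o := by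
  funext k; cases k <;> rfl

@[simp]
theorem update_contents_reversed (l : List (PortraitSymbol d N)) :
    Function.update (contents i r m a o) .reversed l = contents i l m a o := by
  funext k; cases k <;> rfl

@[simp]
theorem update_contents_main (l : List (B ⊕ T)) :
    Function.update (contents i r m a o) .main l = contents i r l a o := by
  funext k; cases k <;> rfl

@[simp]
theorem update_contents_aux (l : List B) :
    Function.update (contents i r m a o) .aux l = contents i r m l o := by
  funext k; cases k <;> rfl

@[simp]
theorem update_contents_output (l : List O) :
    Function.update (contents i r m a o) .output l = contents i r m a l := by
  funext k; cases k <;> rfl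

@[simp] theorem contents_input : contents i r m a o .input = i := rfl
@[simp] theorem contents_reversed : contents i r m a o .reversed = r := rfl
@[simp] theorem contents_main : contents i r m a o .main = m := rfl
@[simp] theorem contents_aux : contents i r m a o .aux = a := rfl
@[simp] theorem contents_output : contents i r m a o .output = o := rfl

end Stacks

@[simp]
-- The fold wraps every further push around the program, so the last entry of the list is pushed
-- first and the head ends on top.
theorem stepAux_pushList (k : Stack) (l : List (Alphabet d N B T O k)) (q : Program d N B T O)
    (v : Register d N B T) (S : ∀ k, List (Alphabet d N B T O k)) :
    TM2.stepAux (pushList k l q) v S = TM2.stepAux q v (Function.update S k (l ++ S k)) := by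
  induction l generalizing q with
  | nil => simp [pushList]
  | cons a l ih =>
    have := ih (.push k (fun _ => a) q)
    simpa [pushList] using this

end PortraitEvaluator

/-! ### Runs of the machine and their step counts -/

/-- `RunsIn f n a b`: the partial function `f`, iterated from `a`, reaches `b` in at most `n`
steps. -/
def RunsIn {α : Type*} (f : α → Option α) (n : ℕ) (a b : α) : Prop :=
  ∃ m ≤ n, (flip bind f)^[m] (some a) = some b

namespace RunsIn

variable {α : Type*} {f : α → Option α} {m n : ℕ} {a b c : α}

theorem refl : RunsIn f 0 a a := ⟨0, le_rfl, rfl⟩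

theorem mono (h : RunsIn f m a b) (hmn : m ≤ n) : RunsIn f n a b :=
  let ⟨k, hk, e⟩ := h
  ⟨k, hk.trans hmn, e⟩

theorem trans (h : RunsIn f m a b) (h' : RunsIn f n b c) : RunsIn f (m + n) a c := by
  obtain ⟨k, hk, e⟩ := h
  obtain ⟨l, hl, e'⟩ := h'
  refine ⟨l + k, by omega, ?_⟩
  rw [Function.iterate_add_apply, e, e']

theorem cast {a' b' : α} (h : RunsIn f m a b) (ha : a = a') (hb : b = b') (hmn : m ≤ n) :
    RunsIn f n a' b' := by
  subst ha hb
  exact h.mono hmn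

theorem step (h : f a = some b) : RunsIn f 1 a b := ⟨1, le_rfl, h⟩

theorem step₂ (h : f a = some b) (h' : f b = some c) : RunsIn f 2 a c :=
  (step h).trans (step h')

end RunsIn

namespace PortraitEvaluator

variable {d : ℕ} {N B T O : Type} (E : PortraitEvaluator d N B T O) [Inhabited T]

/-- The number of steps in which the machine evaluates a portrait (an upper bound). -/
def cost : Portrait d N → ℕ
  | .leaf _ => 2
  | .node _ c => ∑ x, cost (c x) + 2 * ∑ x, ((E.value (c x)).1.length + 1) +
      2 * (∑ x, ((E.value (c x)).1.flatMap (E.subst x)).length) + 4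

/-- The value of a portrait as it is written on the main stack. -/
def block (P : Portrait d N) : List (B ⊕ T) :=
  (E.value P).1.map .inl ++ [.inr (E.value P).2]

/-- The configuration of the machine at a label with empty register. -/
def config (l : Label d N B T) (i r : List (PortraitSymbol d N)) (m : List (B ⊕ T)) (a : List B)
    (o : List O) : TM2.Cfg (Alphabet d N B T O) (Label d N B T) (Register d N B T) :=
  ⟨some l, none, contents i r m a o⟩

variable (i r : List (PortraitSymbol d N)) (m : List (B ⊕ T)) (a : List B) (o : List O)

/-- A symbol costs two steps, the pop and the visit to the `Act` label; the extra step finds the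
stack empty. The other loops are counted in the same way. -/
theorem runsIn_reverse :
    RunsIn (TM2.step E.program) (2 * i.length + 1) (config .reverse i r m a o)
      (config .read [] (i.reverse ++ r) m a o) := by
  induction i generalizing r with
  | nil => exact .step (by simp [config, TM2.step, program])
  | cons s i ih =>
    have h : RunsIn (TM2.step E.program) 2 (config .reverse (s :: i) r m a o)
        (config .reverse i (s :: r) m a o) :=
      .step₂ (b := ⟨some (.reverseAct s), some (.inl s), contents i r m a o⟩)
        (by simp [config, TM2.step, program]) (by simp [config, TM2.step, program])
    simpa using (h.trans (ih _)).mono (n := 2 * (s :: i).length + 1) (by simp; omega)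

theorem runsIn_restore :
    RunsIn (TM2.step E.program) (2 * a.length + 1) (config .restore i r m a o)
      (config .read i r ((a.reverse.map .inl) ++ m) [] o) := by
  induction a generalizing m with
  | nil => exact .step (by simp [config, TM2.step, program])
  | cons b a ih =>
    have h : RunsIn (TM2.step E.program) 2 (config .restore i r m (b :: a) o)
        (config .restore i r (.inl b :: m) a o) :=
      .step₂ (b := ⟨some (.restoreAct b), some (.inr (.inl b)), contents i r m a o⟩)
        (by simp [config, TM2.step, program]) (by simp [config, TM2.step, program])
    simpa using (h.trans (ih (.inl b :: m))).mono (n := 2 * (b :: a).length + 1) (by simp; omega)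

theorem runsIn_emit :
    RunsIn (TM2.step E.program) (2 * a.length + 1) (config .emit i r m a o)
      ⟨none, none, contents i r m [] (a.reverse.flatMap E.outLetter ++ o)⟩ := by
  induction a generalizing o with
  | nil => exact .step (by simp [config, TM2.step, program])
  | cons b a ih =>
    have h : RunsIn (TM2.step E.program) 2 (config .emit i r m (b :: a) o)
        (config .emit i r m a (E.outLetter b ++ o)) :=
      .step₂ (b := ⟨some (.emitAct b), some (.inr (.inl b)), contents i r m a o⟩)
        (by simp [config, TM2.step, program]) (by simp [config, TM2.step, program])
    simpa using (h.trans (ih _)).mono (n := 2 * (b :: a).length + 1) (by simp; omega)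

theorem runsIn_finish (w : List B) (t : T) :
    RunsIn (TM2.step E.program) (2 * w.length + 2)
      (config .finish i r (w.map .inl ++ .inr t :: m) a o)
      (config .emit i r m (w.reverse ++ a) (E.outRep t ++ o)) := by
  induction w generalizing a with
  | nil =>
    exact .step₂ (b := ⟨some (.finishAct (.inr t)), some (.inr (.inr t)), contents i r m a o⟩)
        (by simp [config, TM2.step, program]) (by simp [config, TM2.step, program])
  | cons b w ih =>
    have h : RunsIn (TM2.step E.program) 2
        (config .finish i r ((b :: w).map .inl ++ .inr t :: m) a o)
        (config .finish i r (w.map .inl ++ .inr t :: m) (b :: a) o) :=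
      .step₂ (b := ⟨some (.finishAct (.inl b)), some (.inr (.inl b)),
          contents i r (w.map .inl ++ .inr t :: m) a o⟩)
        (by simp [config, TM2.step, program]) (by simp [config, TM2.step, program])
    simpa using (h.trans (ih _)).mono (n := 2 * (b :: w).length + 2) (by simp; omega)

/-- The element of `T` at the bottom of a block marks its end, so the machine passes to the next
child without knowing the length of the word. -/
theorem runsIn_combine_block (σ : Equiv.Perm (Fin d)) (x : Fin d) (ts : Fin d → T) (w : List B)
    (t : T) :
    RunsIn (TM2.step E.program) (2 * w.length + 2)
      (config (.combine σ x.castSucc ts) i r (w.map .inl ++ .inr t :: m) a o)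
      (config (.combine σ x.succ (Function.update ts x t)) i r m
        ((w.flatMap (E.subst x)).reverse ++ a) o) := by
  induction w generalizing a with
  | nil =>
    exact .step₂ (b := ⟨some (.combineAct σ x ts (.inr t)), some (.inr (.inr t)),
          contents i r m a o⟩)
        (by simp [config, TM2.step, program]) (by simp [config, TM2.step, program])
  | cons b w ih =>
    have h : RunsIn (TM2.step E.program) 2
        (config (.combine σ x.castSucc ts) i r ((b :: w).map .inl ++ .inr t :: m) a o)
        (config (.combine σ x.castSucc ts) i r (w.map .inl ++ .inr t :: m)
          ((E.subst x b).reverse ++ a) o) :=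
      .step₂ (b := ⟨some (.combineAct σ x ts (.inl b)), some (.inr (.inl b)),
          contents i r (w.map .inl ++ .inr t :: m) a o⟩)
        (by simp [config, TM2.step, program]) (by simp [config, TM2.step, program])
    simpa using (h.trans (ih _)).mono (n := 2 * (b :: w).length + 2) (by simp; omega)

end PortraitEvaluator

/-! ### Size bounds and the complete run -/

namespace PortraitEvaluator

variable {d : ℕ} {N B T O : Type} (E : PortraitEvaluator d N B T O)

/-- A bound for the number of steps of the evaluation and the length of the value. -/
def size (P : Portrait d N) : ℕ := E.cost P + (E.value P).1.length

theorem length_encode_le_cost (P : Portrait d N) : P.encode.length ≤ E.cost P := by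
  induction P with
  | leaf n => simp [Portrait.encode, cost]
  | node σ c ih =>
    have h : ∑ x, (c x).encode.length ≤ ∑ x, E.cost (c x) := Finset.sum_le_sum fun x _ => ih x
    simp only [Portrait.encode, cost, List.length_cons, List.length_flatten, List.map_ofFn,
      List.sum_ofFn, Function.comp_apply]
    omega

theorem length_flatMap_le {α β : Type*} {f : α → List β} {C : ℕ} (hf : ∀ a, (f a).length ≤ C)
    (l : List α) : (l.flatMap f).length ≤ C * l.length := by
  induction l with
  | nil => simp
  | cons a l ih =>
    have := hf a
    simp only [List.flatMap_cons, List.length_append, List.length_cons, mul_add]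
    omega

/-- At a vertex, cost and word length are bounded by linear functions of those at the children; the
coefficients are maxima over finite alphabets and tables. -/
theorem exists_size_bound [Finite N] [Finite B] [Finite T] : ∃ C : ℕ, (∀ n, E.size (.leaf n) ≤ C) ∧
    (∀ σ c, E.size (.node σ c) ≤ C * (∑ x, E.size (c x) + 1)) ∧
    ∀ P, (E.output P).length ≤ C * (E.size P + 1) := by
  obtain ⟨C₁, h₁⟩ := Finite.exists_le fun n => (E.leafWord n).length
  obtain ⟨C₂, h₂⟩ := Finite.exists_le fun p : Fin d × B => (E.subst p.1 p.2).length
  obtain ⟨C₃, h₃⟩ := Finite.exists_le fun p : Equiv.Perm (Fin d) × (Fin d → T) =>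
    (E.nodeWord p.1 p.2).length
  obtain ⟨C₄, h₄⟩ := Finite.exists_le fun b => (E.outLetter b).length
  obtain ⟨C₅, h₅⟩ := Finite.exists_le fun t => (E.outRep t).length
  -- The substituted words are counted twice in the cost and once in the length of the value, whence
  -- `3 * C₂`; `C₄` and `C₅` are for the output.
  refine ⟨C₁ + 3 * C₂ + C₃ + C₄ + C₅ + 2 * d + 6, fun n => ?_, fun σ c => ?_, fun P => ?_⟩
  · have := h₁ n
    simp only [size, cost, value]
    omega
  · have h : ∑ x, ((E.value (c x)).1.flatMap (E.subst x)).length ≤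
        C₂ * ∑ x, (E.value (c x)).1.length := by
      rw [Finset.mul_sum]
      exact Finset.sum_le_sum fun x _ => length_flatMap_le (fun b => h₂ (x, b)) _
    have h' := h₃ (σ, fun x => (E.value (c x)).2)
    simp only [size, cost, value, List.length_append, List.length_flatten, List.map_ofFn,
      List.sum_ofFn, Function.comp_apply, Finset.sum_add_distrib, Finset.sum_const,
      Finset.card_univ, Fintype.card_fin, smul_eq_mul, mul_one] at h' ⊢
    generalize ∑ x, ((E.value (c x)).1.flatMap (E.subst x)).length = s at *
    generalize ∑ x, (E.value (c x)).1.length = l at *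
    generalize ∑ x, E.cost (c x) = k at *
    nlinarith [Nat.zero_le (C₁ * (k + l)), Nat.zero_le (C₂ * k), Nat.zero_le (C₃ * (k + l)),
      Nat.zero_le (C₄ * (k + l)), Nat.zero_le (C₅ * (k + l)), Nat.zero_le (d * (k + l))]
  · have h := length_flatMap_le h₄ (E.value P).1
    have h' := h₅ (E.value P).2
    simp only [output, size, List.length_append]
    generalize (E.value P).1.length = l at *
    generalize E.cost P = k at *
    calc _ ≤ C₄ * l + C₅ := Nat.add_le_add h h'
      _ ≤ C₄ * (k + l + 1) + C₅ * (k + l + 1) := by nlinarith [Nat.zero_le (C₄ * k), Nat.zero_le (C₅ * (k + l))]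
      _ = (C₄ + C₅) * (k + l + 1) := by ring
      _ ≤ _ := Nat.mul_le_mul_right _ (by omega)

variable [Inhabited T]

variable (i r : List (PortraitSymbol d N)) (m : List (B ⊕ T)) (a : List B) (o : List O)

/-- The state in the middle of a combination, with children below `k` already processed, is the form
that admits induction on the number `n` of remaining children. -/
theorem runsIn_combine_drop (σ : Equiv.Perm (Fin d)) (w : Fin d → List B) (t : Fin d → T) (n : ℕ)
    (k : Fin (d + 1)) (hk : k.1 + n = d) (ts : Fin d → T)
    (hts : ∀ x : Fin d, x.1 < k.1 → ts x = t x) :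
    RunsIn (TM2.step E.program)
      (((List.finRange d).drop k).map fun x => 2 * (w x).length + 2).sum
      (config (.combine σ k ts) i r
        ((((List.finRange d).drop k).map fun x => (w x).map .inl ++ [.inr (t x)]).flatten ++ m) a o)
      (config (.combine σ (Fin.last d) t) i r m
        ((((List.finRange d).drop k).map fun x => (w x).flatMap (E.subst x)).flatten.reverse ++ a)
        o) := by
  induction n generalizing k ts a with
  | zero =>
    obtain rfl : k = Fin.last d := Fin.ext (by simpa using hk)
    obtain rfl : ts = t := funext fun x => hts x x.2
    have hdrop : (List.finRange d).drop (Fin.last d : Fin (d + 1)) = [] := by simp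
    rw [hdrop]
    simpa using RunsIn.refl
  | succ n ih =>
    have hkd : k.1 < d := by omega
    obtain ⟨x, rfl⟩ : ∃ x : Fin d, k = x.castSucc := ⟨⟨k, hkd⟩, rfl⟩
    have hdrop : (List.finRange d).drop (x.castSucc : Fin (d + 1)) =
        x :: (List.finRange d).drop (x.succ : Fin (d + 1)) := by
      rw [List.drop_eq_getElem_cons (by simp)]
      simp
    rw [hdrop]
    have h := E.runsIn_combine_block i r
      ((((List.finRange d).drop (x.succ : Fin (d + 1))).map
        fun x => (w x).map .inl ++ [.inr (t x)]).flatten ++ m) a o σ x ts (w x) (t x)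
    have h' := ih (((w x).flatMap (E.subst x)).reverse ++ a) x.succ
      (by simp at hk ⊢; omega) (Function.update ts x (t x)) fun y hy => by
        rcases eq_or_ne y x with rfl | hyx
        · simp
        · rw [Function.update_of_ne hyx]
          refine hts y ?_
          have : y.1 ≠ x.1 := fun e => hyx (Fin.ext e)
          simp at hy ⊢
          omega
    simpa using h.trans h'

/-- The final `+ 2` is the step that pushes the table entry and the failing pop that ends `restore`.
-/
theorem runsIn_combine (σ : Equiv.Perm (Fin d)) (c : Fin d → Portrait d N) (ts : Fin d → T) :
    RunsIn (TM2.step E.program)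
      (2 * ∑ x, ((E.value (c x)).1.length + 1) +
        2 * (∑ x, ((E.value (c x)).1.flatMap (E.subst x)).length) + 2)
      (config (.combine σ 0 ts) i r ((List.ofFn fun x => E.block (c x)).flatten ++ m) [] o)
      (config .read i r (E.block (.node σ c) ++ m) [] o) := by
  have h := E.runsIn_combine_drop i r m [] o σ (fun x => (E.value (c x)).1)
    (fun x => (E.value (c x)).2) d 0 (by simp) ts (fun x hx => absurd hx (by simp))
  set W := ((List.finRange d).map fun x => (E.value (c x)).1.flatMap (E.subst x)).flatten with hW
  have h1 : RunsIn (TM2.step E.program) 1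
      (config (.combine σ (Fin.last d) fun x => (E.value (c x)).2) i r m W.reverse o)
      (config .restore i r
        ((E.nodeWord σ fun x => (E.value (c x)).2).map .inl ++
          .inr (E.nodeRep σ fun x => (E.value (c x)).2) :: m) W.reverse o) :=
    .step (by simp [config, TM2.step, program])
  simp only [Fin.coe_ofNat_eq_mod, Nat.zero_mod, List.drop_zero, List.append_nil, ← hW] at h
  have h2 := h.trans (h1.trans (E.runsIn_restore i r _ W.reverse o))
  have hlen : W.length = ∑ x, ((E.value (c x)).1.flatMap (E.subst x)).length := by
    rw [hW, List.length_flatten, List.map_map, ← List.ofFn_eq_map, List.sum_ofFn]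
    rfl
  have hsum : ((List.finRange d).map fun x => 2 * (E.value (c x)).1.length + 2).sum =
      2 * ∑ x, ((E.value (c x)).1.length + 1) := by
    rw [← List.ofFn_eq_map, List.sum_ofFn, Finset.mul_sum]
    rfl
  have e1 : (List.ofFn fun x => E.block (c x)) =
      (List.finRange d).map fun x => (E.value (c x)).1.map .inl ++ [.inr (E.value (c x)).2] := by
    rw [List.ofFn_eq_map]; rfl
  have e2 : E.block (.node σ c) =
      W.map .inl ++ ((E.nodeWord σ fun x => (E.value (c x)).2).map .inl ++
        [.inr (E.nodeRep σ fun x => (E.value (c x)).2)]) := by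
    simp [block, value, hW, List.ofFn_eq_map]
  refine h2.cast (by rw [e1]) (by simp [e2]) ?_
  rw [hsum, List.length_reverse, hlen]
  omega

theorem runsIn_read_list (cs : List (Portrait d N))
    (h : ∀ P ∈ cs, ∀ r m, RunsIn (TM2.step E.program) (E.cost P)
      (config .read i (P.encode.reverse ++ r) m [] o) (config .read i r (E.block P ++ m) [] o)) :
    RunsIn (TM2.step E.program) (cs.map E.cost).sum
      (config .read i ((cs.map Portrait.encode).flatten.reverse ++ r) m [] o)
      (config .read i r ((cs.map E.block).flatten ++ m) [] o) := by
  induction cs generalizing r with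
  | nil => simpa using RunsIn.refl
  | cons P cs ih =>
    -- The code is read backwards, so the tail of the list is processed before its head, whose block
    -- ends on top.
    have h1 := ih (P.encode.reverse ++ r) fun Q hQ => h Q (List.mem_cons_of_mem _ hQ)
    have h2 := h P List.mem_cons_self r ((cs.map E.block).flatten ++ m)
    simpa [add_comm] using h1.trans h2

/-- In reversed preorder all children precede their parent. When the label `σ` is reached, the
blocks of the children are on the main stack, that of child `0` on top. -/
theorem runsIn_read (P : Portrait d N) :
    RunsIn (TM2.step E.program) (E.cost P) (config .read i (P.encode.reverse ++ r) m [] o)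
      (config .read i r (E.block P ++ m) [] o) := by
  induction P generalizing r m with
  | leaf n =>
    exact .step₂ (b := ⟨some (.readAct (.inr n)), some (.inl (.inr n)), contents i r m [] o⟩)
        (by simp [config, TM2.step, program, Portrait.encode])
        (by simp [config, TM2.step, program, block, value])
  | node σ c ih =>
    have h1 := E.runsIn_read_list i (.inl σ :: r) m o (List.ofFn c) fun P hP => by
      obtain ⟨x, rfl⟩ := List.mem_ofFn.1 hP
      exact ih x
    have h2 : RunsIn (TM2.step E.program) 2
        (config .read i (.inl σ :: r) ((List.ofFn fun x => E.block (c x)).flatten ++ m) [] o)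
        (config (.combine σ 0 fun _ => default) i r
          ((List.ofFn fun x => E.block (c x)).flatten ++ m) [] o) :=
      .step₂ (b := ⟨some (.readAct (.inl σ)), some (.inl (.inl σ)),
          contents i r ((List.ofFn fun x => E.block (c x)).flatten ++ m) [] o⟩)
        (by simp [config, TM2.step, program]) (by simp [config, TM2.step, program])
    have h3 := h2.trans (E.runsIn_combine i r m o σ c fun _ => default)
    simp only [List.map_ofFn, Function.comp_def] at h1
    have h4 := h1.trans h3
    refine h4.cast (by simp [Portrait.encode]) rfl ?_
    simp only [cost, List.sum_ofFn]
    omega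

theorem runsIn_machine (P : Portrait d N) :
    RunsIn (TM2.step E.program)
      (2 * P.encode.length + E.cost P + 4 * (E.value P).1.length + 5)
      (config .reverse P.encode [] [] [] [])
      ⟨none, none, contents [] [] [] [] (E.output P)⟩ := by
  have h1 := E.runsIn_reverse P.encode [] [] [] []
  have h2 := E.runsIn_read [] [] [] [] P
  have h3 : RunsIn (TM2.step E.program) 1 (config .read [] [] (E.block P ++ []) [] [])
      (config .finish [] [] (E.block P ++ []) [] []) :=
    .step (by simp [config, TM2.step, program])
  have h4 := E.runsIn_finish [] [] [] [] [] (E.value P).1 (E.value P).2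
  have h5 := E.runsIn_emit [] [] [] ((E.value P).1.reverse ++ []) (E.outRep (E.value P).2 ++ [])
  have e : E.block P ++ [] = (E.value P).1.map .inl ++ .inr (E.value P).2 :: [] := by simp [block]
  rw [← e] at h4
  refine (((h1.trans h2).trans h3).trans (h4.trans h5)).cast rfl (by simp [output]) ?_
  simp
  omega

variable [Finite N] [Finite B] [Finite T]

/-- The Turing machine that evaluates portraits. All its stack alphabets are finite if `N`, `B`,
`T` and `O` are. -/
noncomputable def machine : FinTM2 where
  K := Stack
  k₀ := .input
  k₁ := .output
  Γ := Alphabet d N B T O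
  Λ := Label d N B T
  main := .reverse
  ΛFin := .ofFinite _
  σ := Register d N B T
  initialState := none
  σFin := .ofFinite _
  Γk₀Fin := .ofFinite (PortraitSymbol d N)
  m := E.program

theorem outputsInTime_machine (P : Portrait d N) {n : ℕ}
    (hn : 2 * P.encode.length + E.cost P + 4 * (E.value P).1.length + 5 ≤ n) :
    Nonempty (TM2OutputsInTime E.machine P.encode (some (E.output P)) n) := by
  obtain ⟨k, hk, h⟩ := E.runsIn_machine P
  have e1 : initList E.machine P.encode = config .reverse P.encode [] [] [] [] := by
    refine congrArg (TM2.Cfg.mk (some Label.reverse) none) (funext fun k => ?_)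
    cases k <;> rfl
  have e2 : haltList E.machine (E.output P) =
      ⟨none, none, contents [] [] [] [] (E.output P)⟩ := by
    refine congrArg (TM2.Cfg.mk none none) (funext fun k => ?_)
    cases k <;> rfl
  refine ⟨⟨⟨k, ?_⟩, hk.trans hn⟩⟩
  rw [e1]
  exact h.trans (congrArg some e2.symm)

end PortraitEvaluator

/-! ### Words, sections and elements with prescribed sections -/

namespace SelfSimilar

variable {d : ℕ} {S : Set (TreeAut d)}

namespace GenWord

theorem eval_nil : eval ([] : GenWord S) = 1 := rfl

theorem eval_cons (a : S × Bool) (w : GenWord S) :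
    eval (a :: w) = eval [a] * eval w := by
  simp [eval]

theorem eval_append (w w' : GenWord S) : eval (w ++ w') = eval w * eval w' := by
  simp [eval]

theorem eval_mem_closure (w : GenWord S) : eval w ∈ Subgroup.closure S := by
  refine Subgroup.list_prod_mem _ fun g hg => ?_
  obtain ⟨⟨s, b⟩, -, rfl⟩ := List.mem_map.1 hg
  cases b
  · exact inv_mem (Subgroup.subset_closure s.2)
  · exact Subgroup.subset_closure s.2

theorem exists_eval_eq {g : TreeAut d} (hg : g ∈ Subgroup.closure S) :
    ∃ w : GenWord S, w.eval = g := by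
  obtain ⟨l, hl, rfl⟩ := Submonoid.exists_list_of_mem_closure
    (Subgroup.closure_toSubmonoid S ▸ hg : g ∈ Submonoid.closure (S ∪ S⁻¹))
  clear hg
  induction l with
  | nil => exact ⟨[], rfl⟩
  | cons a l ih =>
    obtain ⟨w, hw⟩ := ih fun y hy => hl y (List.mem_cons_of_mem _ hy)
    rcases hl a List.mem_cons_self with ha | ha
    · exact ⟨(⟨a, ha⟩, true) :: w, by rw [eval_cons, hw]; simp [eval]⟩
    · exact ⟨(⟨a⁻¹, ha⟩, false) :: w, by rw [eval_cons, hw]; simp [eval]⟩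

theorem eval_flatMap {A : Set (TreeAut d)} {f : A × Bool → GenWord S}
    (hf : ∀ a, (f a).eval = eval [a]) (w : GenWord A) :
    eval (S := S) (w.flatMap f) = w.eval := by
  induction w with
  | nil => rfl
  | cons a w ih => rw [List.flatMap_cons, eval_append, ih, hf, ← eval_cons]

end GenWord

theorem sectionAt_inv_of_fixed {h : TreeAut d} {v : List (Fin d)} (hv : h v = v) :
    h⁻¹.sectionAt v = (h.sectionAt v)⁻¹ := by
  have e := TreeAut.section_mul h h⁻¹ v
  rw [mul_inv_cancel, TreeAut.section_one, hv] at e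
  exact eq_inv_of_mul_eq_one_right e.symm

/-- This makes the table at inner vertices well defined: a root permutation and a tuple of sections
belong to at most one automorphism. -/
theorem ext_of_firstLevel {g h : TreeAut d} (h₁ : ∀ x : Fin d, g [x] = h [x])
    (h₂ : ∀ x : Fin d, g.sectionAt [x] = h.sectionAt [x]) : g = h := by
  refine TreeAut.ext_apply fun v => ?_
  cases v with
  | nil =>
    rw [List.length_eq_zero_iff.1 (g.length_map []), List.length_eq_zero_iff.1 (h.length_map [])]
  | cons x v =>
    have e₁ := g.apply_append [x] v
    have e₂ := h.apply_append [x] v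
    rw [h₁, h₂] at e₁
    exact e₁.trans e₂.symm

/-- The automorphism `h` is an element of `K` and the first level stabilizer with sections `f`. -/
def HasSections (K : Subgroup (TreeAut d)) (h : TreeAut d) (f : Fin d → TreeAut d) : Prop :=
  h ∈ K ∧ (∀ x : Fin d, h [x] = [x]) ∧ ∀ x : Fin d, h.sectionAt [x] = f x

namespace HasSections

variable {K : Subgroup (TreeAut d)} {h h' : TreeAut d} {f f' : Fin d → TreeAut d}

theorem one : HasSections K 1 1 :=
  ⟨one_mem K, fun _ => rfl, fun x => TreeAut.section_one [x]⟩

theorem mul (H : HasSections K h f) (H' : HasSections K h' f') :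
    HasSections K (h * h') (f * f') :=
  ⟨mul_mem H.1 H'.1, fun x => by rw [TreeAut.mul_apply, H.2.1, H'.2.1],
    fun x => by rw [TreeAut.section_mul, H.2.1, H.2.2, H'.2.2]; rfl⟩

theorem list_prod {ι : Type*} {h : ι → TreeAut d} {f : ι → Fin d → TreeAut d}
    (H : ∀ i, HasSections K (h i) (f i)) (l : List ι) :
    HasSections K (l.map h).prod (l.map f).prod := by
  induction l with
  | nil => exact one
  | cons i l ih => simpa using (H i).mul ih

end HasSections

/-- The factors live in different coordinates, so commutativity is not needed. It yields the
sections of the concatenated words of all children. -/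
theorem list_prod_mulSingle_finRange {M : Type*} [Monoid M] (k : Fin d → M) :
    ((List.finRange d).map fun x => Pi.mulSingle x (k x)).prod = k := by
  have h : ∀ l : List (Fin d), l.Nodup →
      (l.map fun x => Pi.mulSingle x (k x)).prod = fun y => if y ∈ l then k y else 1 := by
    intro l hl
    induction l with
    | nil => rfl
    | cons x l ih =>
      rw [List.nodup_cons] at hl
      rw [List.map_cons, List.prod_cons, ih hl.2]
      funext y
      rcases eq_or_ne y x with rfl | hy
      · simp [hl.1]
      · simp [hy]
  rw [h _ (List.nodup_finRange d)]
  simp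

/-- Here the branching inclusion enters: a tuple with one nontrivial entry from `K` lies in `K × ⋯ ×
K`. It supplies the substitution words. -/
theorem exists_hasSections_mulSingle {K : Subgroup (TreeAut d)}
    (hK : directPower K ≤ sectionsImage K) (x : Fin d) {k : TreeAut d} (hk : k ∈ K) :
    ∃ h, HasSections K h (Pi.mulSingle x k) := by
  have hmem : (Pi.mulSingle x k : Fin d → TreeAut d) ∈ directPower K := by
    intro y _
    rcases eq_or_ne y x with rfl | hy
    · simpa using hk
    · simp [Pi.mulSingle_eq_of_ne hy]
  obtain ⟨h, hh, e⟩ := hK hmem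
  exact ⟨h, hh, h.2, fun y => congrFun e y⟩

/-! ### Logarithmic depth of portraits -/

/-- In a contracting group, finitely many elements contract to the nucleus at a common level. -/
theorem exists_common_level {G : Subgroup (TreeAut d)} (hG : IsContracting G)
    {F : Set (TreeAut d)} (hF : F.Finite) (hFG : F ⊆ G) :
    ∃ l, ∀ g ∈ F, ∀ v : List (Fin d), v.length = l → g.sectionAt v ∈ nucleus G := by
  choose! l hl using (isLeast_nucleus hG).1.contracts
  obtain ⟨M, hM⟩ := (hF.image l).bddAbove
  exact ⟨M, fun g hg v hv => hl g (hFG hg) M (hM (Set.mem_image_of_mem l hg)) v hv⟩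

/-- A product of at most `2 ^ j` elements of `N` has its sections at level `l * j` in `N`, if the
products of two elements of `N` have their sections at level `l` in `N`. -/
theorem sectionAt_list_prod_mem {N : Set (TreeAut d)} (h1 : 1 ∈ N) {l : ℕ}
    (hl : ∀ g ∈ N, ∀ h ∈ N, ∀ v : List (Fin d), v.length = l → (g * h).sectionAt v ∈ N)
    (j : ℕ) (L : List (TreeAut d)) (hL : ∀ g ∈ L, g ∈ N) (hlen : L.length ≤ 2 ^ j)
    (v : List (Fin d)) (hv : v.length = l * j) : L.prod.sectionAt v ∈ N := by
  induction j generalizing L v with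
  | zero =>
    obtain rfl : v = [] := List.length_eq_zero_iff.1 (by simpa using hv)
    rw [TreeAut.section_nil]
    match L, hlen with
    | [], _ => simpa using h1
    | [g], _ => simpa using hL
  | succ j ih =>
    have hdrop : (L.drop (2 ^ j)).length ≤ 2 ^ j := by
      rw [List.length_drop]; rw [pow_succ] at hlen; omega
    have hv₁ : (v.take (l * j)).length = l * j := by
      rw [List.length_take, hv]; exact min_eq_left (by rw [mul_add]; omega)
    have hv₂ : (v.drop (l * j)).length = l := by
      rw [List.length_drop, hv, mul_add, mul_one]; omega
    -- Split the product into halves and the vertex into levels `l * j` and `l`. By induction each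
    -- half has its section in `N` at the first part (for the second half, at the image of that
    -- vertex); `l` more levels contract the product of the two.
    rw [← List.prod_take_mul_prod_drop L (2 ^ j), ← List.take_append_drop (l * j) v,
      TreeAut.section_append, TreeAut.section_mul]
    exact hl _ (ih _ (fun g hg => hL g (List.mem_of_mem_take hg)) (by simp) _ hv₁)
      _ (ih _ (fun g hg => hL g (List.mem_of_mem_drop hg)) hdrop _ (by rw [TreeAut.length_map, hv₁]))
      _ hv₂

/-- Sections of words are products of sections of letters. -/
theorem GenWord.exists_sectionAt_eval_eq_prod {N : Set (TreeAut d)} {l : ℕ}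
    (hl : ∀ a : S × Bool, ∀ v : List (Fin d), v.length = l → (eval [a]).sectionAt v ∈ N)
    (u : GenWord S) (v : List (Fin d)) (hv : v.length = l) :
    ∃ L : List (TreeAut d), (∀ g ∈ L, g ∈ N) ∧ L.length = u.length ∧
      u.eval.sectionAt v = L.prod := by
  induction u generalizing v with
  | nil => exact ⟨[], by simp, rfl, TreeAut.section_one v⟩
  | cons a u ih =>
    obtain ⟨L, h1, h2, h3⟩ := ih (eval [a] v) (by rw [TreeAut.length_map, hv])
    refine ⟨(eval [a]).sectionAt v :: L, ?_, by simp [h2], ?_⟩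
    · simpa using ⟨hl a v hv, h1⟩
    · rw [eval_cons, TreeAut.section_mul, h3, List.prod_cons]

/-- An element represented by a word of length `n` contracts to the nucleus at a level that is
logarithmic in `n`. -/
theorem exists_logarithmic_level {G : Subgroup (TreeAut d)} (hG : IsContracting G)
    (hS : S.Finite) (hSG : Subgroup.closure S = G) :
    ∃ a b : ℕ, ∀ (u : GenWord S) (v : List (Fin d)), v.length = a + b * Nat.clog 2 u.length →
      u.eval.sectionAt v ∈ nucleus G := by
  have hnuc := (isLeast_nucleus hG).1
  have hS' : Finite S := hS
  -- The identity is adjoined to cover empty products and to treat a single factor as a product of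
  -- two.
  set N : Set (TreeAut d) := insert 1 (nucleus G) with hN
  have hNfin : N.Finite := hnuc.finite.insert 1
  have hNG : N ⊆ G := Set.insert_subset (one_mem G) hnuc.subset
  obtain ⟨l₀, h₀⟩ := exists_common_level hG
    (Set.finite_range fun a : S × Bool => GenWord.eval [a])
    (by rintro _ ⟨a, rfl⟩; exact hSG ▸ GenWord.eval_mem_closure [a])
  obtain ⟨l, hl⟩ := exists_common_level hG (hNfin.image2 (· * ·) hNfin)
    (by rintro _ ⟨g, hg, h, hh, rfl⟩; exact mul_mem (hNG hg) (hNG hh))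
  -- The first `l₀` levels bring the letters into the nucleus, the next `l * clog` reduce their
  -- product to one element of `N`, and the last `l` lead from `N` into the nucleus itself.
  refine ⟨l₀ + l, l, fun u v hv => ?_⟩
  obtain ⟨v₀, w, rfl, hv₀⟩ : ∃ v₀ w, v₀ ++ w = v ∧ v₀.length = l₀ :=
    ⟨v.take l₀, v.drop l₀, List.take_append_drop _ _, by
      rw [List.length_take]; exact min_eq_left (by omega)⟩
  obtain ⟨v₁, v₂, rfl, hv₁⟩ : ∃ v₁ v₂, v₁ ++ v₂ = w ∧ v₁.length = l * Nat.clog 2 u.length :=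
    ⟨w.take _, w.drop _, List.take_append_drop _ _, by
      rw [List.length_take]; exact min_eq_left (by rw [List.length_append] at hv; omega)⟩
  have hv₂ : v₂.length = l := by simp only [List.length_append] at hv; omega
  obtain ⟨L, h1, h2, h3⟩ := GenWord.exists_sectionAt_eval_eq_prod (N := N)
    (fun a v hv => Set.mem_insert_of_mem _ (h₀ _ ⟨a, rfl⟩ v hv)) u v₀ hv₀
  have h4 := sectionAt_list_prod_mem (Set.mem_insert 1 _)
    (fun g hg h hh v hv => Set.mem_insert_of_mem _ (hl _ ⟨g, hg, h, hh, rfl⟩ v hv))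
    (Nat.clog 2 u.length) L h1 (h2 ▸ Nat.le_pow_clog one_lt_two _) v₁ hv₁
  rw [TreeAut.section_append, TreeAut.section_append, h3]
  simpa using hl _ ⟨_, h4, 1, Set.mem_insert 1 _, rfl⟩ v₂ hv₂

/-- A quantity that grows at most linearly at every vertex of a portrait grows at most
exponentially in the depth of the portrait. -/
theorem IsNucleusPortrait.le_pow {G : Subgroup (TreeAut d)} {s : Portrait d (nucleus G) → ℕ}
    {C : ℕ} (hleaf : ∀ n, s (.leaf n) ≤ C)
    (hnode : ∀ σ c, s (.node σ c) ≤ C * (∑ x, s (c x) + 1))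
    {g : TreeAut d} {P : Portrait d (nucleus G)} (hP : IsNucleusPortrait G g P) (D : ℕ)
    (hD : ∀ v : List (Fin d), v.length = D → g.sectionAt v ∈ nucleus G) :
    s P ≤ ((C + 1) * (d + 1)) ^ (D + 1) := by
  -- The factor `d + 1` accounts for the `d` children and the additive one in `hnode`.
  set F := (C + 1) * (d + 1) with hF
  have hF1 : 1 ≤ F := Nat.one_le_iff_ne_zero.2 (by positivity)
  induction hP generalizing D with
  | leaf g hg =>
    calc s _ ≤ C := hleaf _
      _ ≤ F := by rw [hF]; nlinarith
      _ ≤ _ := Nat.le_self_pow (by omega) _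
  | node g hg σ hσ c hc ih =>
    cases D with
    | zero => exact absurd (by simpa [TreeAut.section_nil] using hD [] rfl) hg
    | succ D =>
      have h : ∀ x, s (c x) ≤ F ^ (D + 1) := fun x => ih x D fun v hv => by
        rw [← TreeAut.section_append]
        exact hD _ (by simp [hv])
      have hsum : ∑ x, s (c x) ≤ d * F ^ (D + 1) := by
        simpa using Finset.sum_le_sum fun x (_ : x ∈ Finset.univ) => h x
      calc s _ ≤ C * (∑ x, s (c x) + 1) := hnode σ c
        _ ≤ (C + 1) * (d * F ^ (D + 1) + F ^ (D + 1)) := by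
          gcongr
          · omega
          · exact Nat.one_le_pow _ _ hF1
        _ = F ^ (D + 1 + 1) := by rw [hF]; ring

/-! ### The evaluator of a regular branch group -/

/-- Schreier's lemma: a subgroup of finite index in a finitely generated group is finitely
generated. -/
theorem exists_finite_closure_eq {G K : Subgroup (TreeAut d)} (hKG : K ≤ G)
    (hK : K.relIndex G ≠ 0) (hG : G.FG) :
    ∃ A : Set (TreeAut d), A.Finite ∧ Subgroup.closure A = K := by
  have := (Group.fg_iff_subgroup_fg G).2 hG
  have : (K.subgroupOf G).FiniteIndex := ⟨hK⟩
  obtain ⟨A, hA⟩ : (K.subgroupOf G).FG :=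
    (Group.fg_iff_subgroup_fg _).1 (Subgroup.fg_of_index_ne_zero _)
  refine ⟨G.subtype '' A, A.finite_toSet.image _, ?_⟩
  rw [← MonoidHom.map_closure, hA, Subgroup.subgroupOf_map_subtype, inf_of_le_left hKG]

/-- Representatives of the right cosets of `K` in `G`. -/
theorem exists_mul_representative {G K : Subgroup (TreeAut d)} :
    ∃ rep : (G ⧸ K.subgroupOf G) → TreeAut d, (∀ t, rep t ∈ G) ∧
      ∀ g ∈ G, ∃ t, ∃ k ∈ K, g = k * rep t := by
  -- The quotient consists of left cosets; inversion turns their representatives into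
  -- representatives of right cosets.
  refine ⟨fun t => (t.out : TreeAut d)⁻¹, fun t => inv_mem t.out.2, fun g hg => ?_⟩
  obtain ⟨k, hk⟩ := QuotientGroup.mk_out_eq_mul (K.subgroupOf G) (⟨g, hg⟩ : G)⁻¹
  refine ⟨((⟨g, hg⟩ : G)⁻¹ : G), k.1, k.2, ?_⟩
  simp [hk]

section Evaluator

variable {G K : Subgroup (TreeAut d)} {A : Set (TreeAut d)} {T : Type}

/-- An evaluator is compatible with `rep : T → TreeAut d` and the group `G` if values `(w, t)` that
represent the sections of `g` are combined to a value that represents `g`, where `(w, t)` stands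
for `eval w * rep t`. -/
structure IsCompatible (G K : Subgroup (TreeAut d)) (rep : T → TreeAut d)
    (E : PortraitEvaluator d (nucleus G) (A × Bool) T (S × Bool)) : Prop where
  leaf : ∀ n, GenWord.eval (E.leafWord n) * rep (E.leafRep n) = n
  subst : ∀ x b, HasSections K (GenWord.eval (E.subst x b)) (Pi.mulSingle x (GenWord.eval [b]))
  node : ∀ g ∈ G, ∀ σ : Equiv.Perm (Fin d), (∀ x, g [x] = [σ x]) → ∀ ts : Fin d → T,
    (∀ x, g.sectionAt [x] = rep (ts x)) → GenWord.eval (E.nodeWord σ ts) * rep (E.nodeRep σ ts) = g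
  outLetter : ∀ b, GenWord.eval (E.outLetter b) = GenWord.eval [b]
  outRep : ∀ t, GenWord.eval (E.outRep t) = rep t

namespace IsCompatible

variable {rep : T → TreeAut d} {E : PortraitEvaluator d (nucleus G) (A × Bool) T (S × Bool)}

theorem hasSections_flatMap (hE : IsCompatible G K rep E) (x : Fin d) (w : GenWord A) :
    HasSections K (GenWord.eval (S := A) (w.flatMap (E.subst x))) (Pi.mulSingle x w.eval) := by
  induction w with
  | nil => simpa [GenWord.eval_nil] using HasSections.one
  | cons b w ih =>
    rw [List.flatMap_cons, GenWord.eval_append, GenWord.eval_cons, Pi.mulSingle_mul]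
    exact (hE.subst x b).mul ih

theorem eval_value (hE : IsCompatible G K rep E) (hKG : K ≤ G)
    (hG : IsSelfSimilar (G : Set (TreeAut d)))
    {g : TreeAut d} {P : Portrait d (nucleus G)} (hP : IsNucleusPortrait G g P) (hg : g ∈ G) :
    GenWord.eval (E.value P).1 * rep (E.value P).2 = g := by
  induction hP with
  | leaf g hgN => exact hE.leaf ⟨g, hgN⟩
  | node g _ σ hσ c _ ih =>
    have hsec := fun x => ih x (hG g hg [x])
    have hprod : ∀ l : List (Fin d),
        GenWord.eval (S := A) (l.map fun x => (E.value (c x)).1.flatMap (E.subst x)).flatten =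
        (l.map fun x => GenWord.eval (S := A) ((E.value (c x)).1.flatMap (E.subst x))).prod := by
      intro l
      induction l with
      | nil => rfl
      | cons x l ih => simp only [List.map_cons, List.flatten_cons, List.prod_cons,
          GenWord.eval_append, ih]
    have H := HasSections.list_prod (fun x => hE.hasSections_flatMap x (E.value (c x)).1)
      (List.finRange d)
    rw [← hprod, list_prod_mulSingle_finRange] at H
    simp only [PortraitEvaluator.value, List.ofFn_eq_map, GenWord.eval_append]
    generalize GenWord.eval (S := A)
      ((List.finRange d).map fun x => (E.value (c x)).1.flatMap (E.subst x)).flatten = h at *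
    -- The substituted words represent `h` in `K`, whose sections are the `K`-parts of the sections
    -- of `g`. Hence `h⁻¹ * g` keeps the root permutation `σ`, its sections are the representatives
    -- alone, and the table gives it.
    rw [mul_assoc, hE.node (h⁻¹ * g) (mul_mem (inv_mem (hKG H.1)) hg) σ, mul_inv_cancel_left]
    · intro x
      rw [TreeAut.mul_apply, TreeAut.inv_apply, h.toPerm.symm_apply_eq.2 (H.2.1 x).symm, hσ]
    · intro x
      have hx : h⁻¹ [x] = [x] := h.toPerm.symm_apply_eq.2 (H.2.1 x).symm
      rw [TreeAut.section_mul, hx, sectionAt_inv_of_fixed (H.2.1 x), H.2.2, ← hsec x,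
        inv_mul_cancel_left]

theorem eval_output (hE : IsCompatible G K rep E) (hKG : K ≤ G)
    (hG : IsSelfSimilar (G : Set (TreeAut d)))
    {g : TreeAut d} {P : Portrait d (nucleus G)} (hP : IsNucleusPortrait G g P) (hg : g ∈ G) :
    GenWord.eval (E.output P) = g := by
  rw [PortraitEvaluator.output, GenWord.eval_append, GenWord.eval_flatMap hE.outLetter, hE.outRep,
    hE.eval_value hKG hG hP hg]

end IsCompatible

theorem exists_isCompatible {rep : T → TreeAut d} (hGK : IsRegularBranchOver G K)
    (hnuc : nucleus G ⊆ G) (hA : Subgroup.closure A = K) (hS : Subgroup.closure S = G)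
    (hrep : ∀ t, rep t ∈ G) (hdec : ∀ g ∈ G, ∃ t, ∃ k ∈ K, g = k * rep t) :
    ∃ E : PortraitEvaluator d (nucleus G) (A × Bool) T (S × Bool), IsCompatible G K rep E := by
  have hdec' : ∀ g ∈ G, ∃ w : GenWord A, ∃ t, w.eval * rep t = g := fun g hg => by
    obtain ⟨t, k, hk, rfl⟩ := hdec g hg
    obtain ⟨w, rfl⟩ := GenWord.exists_eval_eq (hA ▸ hk : k ∈ Subgroup.closure A)
    exact ⟨w, t, rfl⟩
  have hword : ∀ g ∈ G, ∃ w : GenWord S, w.eval = g := fun g hg =>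
    GenWord.exists_eval_eq (hS ▸ hg)
  have hAK : ∀ b : A × Bool, GenWord.eval [b] ∈ K := fun b => hA ▸ GenWord.eval_mem_closure [b]
  have hsub : ∀ (x : Fin d) (b : A × Bool), ∃ w : GenWord A,
      HasSections K w.eval (Pi.mulSingle x (GenWord.eval [b])) := fun x b => by
    obtain ⟨h, hh⟩ := exists_hasSections_mulSingle hGK.geometrically_contains x (hAK b)
    obtain ⟨w, rfl⟩ := GenWord.exists_eval_eq (hA ▸ hh.1 : h ∈ Subgroup.closure A)
    exact ⟨w, hh⟩
  have hnode : ∀ (σ : Equiv.Perm (Fin d)) (ts : Fin d → T), ∃ w : GenWord A, ∃ t, ∀ g ∈ G,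
      (∀ x, g [x] = [σ x]) → (∀ x, g.sectionAt [x] = rep (ts x)) → w.eval * rep t = g := by
    intro σ ts
    by_cases h : ∃ g ∈ G, (∀ x, g [x] = [σ x]) ∧ ∀ x, g.sectionAt [x] = rep (ts x)
    · obtain ⟨g, hg, h₁, h₂⟩ := h
      obtain ⟨w, t, e⟩ := hdec' g hg
      exact ⟨w, t, fun g' _ h₁' h₂' => e.trans <| ext_of_firstLevel
        (fun x => (h₁ x).trans (h₁' x).symm) fun x => (h₂ x).trans (h₂' x).symm⟩
    -- No element of `G` has these data, so the table entry is arbitrary.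
    · exact ⟨[], (hdec 1 (one_mem G)).choose, fun g hg h₁ h₂ => absurd ⟨g, hg, h₁, h₂⟩ h⟩
  choose lw lt hl using fun n : nucleus G => hdec' n (hnuc n.2)
  choose sub hsub using hsub
  choose nw nt hn using hnode
  choose ol hol using fun b => hword _ (hGK.le (hAK b))
  choose ot hot using fun t => hword _ (hrep t)
  exact ⟨⟨lw, lt, sub, nw, nt, ol, ot⟩, hl, hsub, fun g hg σ h₁ ts h₂ => hn σ ts g hg h₁ h₂,
    hol, hot⟩

end Evaluator

/-! ### The polynomial bound and the conclusion -/

/-- An exponential of the logarithm is bounded by a polynomial. -/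
theorem exists_pow_clog_le (F a b : ℕ) :
    ∃ p : Polynomial ℕ, ∀ n, F ^ (a + b * Nat.clog 2 n) ≤ p.eval n := by
  -- With `F ^ b ≤ 2 ^ (F ^ b)`, exchanging exponents leaves a fixed power of `2 ^ clog 2 n`, which
  -- is at most `2 * n + 1`; the `+ 1` covers `n = 0`.
  refine ⟨Polynomial.C (F ^ a) * (2 * Polynomial.X + 1) ^ (F ^ b), fun n => ?_⟩
  have h : 2 ^ Nat.clog 2 n ≤ 2 * n + 1 := by
    rcases Nat.lt_or_ge 1 n with hn | hn
    · have h1 := Nat.pow_pred_clog_lt_self one_lt_two hn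
      have h2 := Nat.clog_pos one_lt_two hn
      obtain ⟨m, hm⟩ := Nat.exists_eq_succ_of_ne_zero h2.ne'
      rw [hm] at h1 ⊢
      simp only [Nat.pred_succ, pow_succ] at h1 ⊢
      omega
    · rw [Nat.clog_of_right_le_one hn]
      omega
  simp only [Polynomial.eval_mul, Polynomial.eval_C, Polynomial.eval_pow, Polynomial.eval_add,
    Polynomial.eval_ofNat, Polynomial.eval_X, Polynomial.eval_one]
  calc F ^ (a + b * Nat.clog 2 n) = F ^ a * (F ^ b) ^ Nat.clog 2 n := by rw [pow_add, pow_mul]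
    _ ≤ F ^ a * (2 ^ (F ^ b)) ^ Nat.clog 2 n := by
      exact Nat.mul_le_mul_left _ (Nat.pow_le_pow_left Nat.lt_two_pow_self.le _)
    _ = F ^ a * (2 ^ Nat.clog 2 n) ^ (F ^ b) := by rw [← pow_mul, ← pow_mul, mul_comm (F ^ b)]
    _ ≤ _ := by gcongr

end SelfSimilar

theorem mainTheorem1 (d : ℕ) (G : Subgroup (TreeAut d))
    (hself : SelfSimilar.IsSelfSimilar (G : Set (TreeAut d)))
    (hcontr : SelfSimilar.IsContracting G)
    (hbranch : SelfSimilar.IsRegularBranch G)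
    (S : Set (TreeAut d)) (hfin : S.Finite) (hgen : Subgroup.closure S = G)
    (hnuc : SelfSimilar.nucleus G ⊆ S) :
    ∃ (M : Turing.TM2ComputableAux
        (SelfSimilar.PortraitSymbol d (SelfSimilar.nucleus G)) (S × Bool))
      (p : Polynomial ℕ),
      ∀ g : G, ∃ w : SelfSimilar.GenWord S, w.eval = g ∧
        ∀ u : SelfSimilar.GenWord S, u.eval = g →
          w.length ≤ p.eval u.length ∧
          Nonempty (Turing.TM2OutputsInTime M.tm
            ((SelfSimilar.nucleusPortrait hcontr g).encode.map M.inputAlphabet.symm)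
            (some (w.map M.outputAlphabet.symm))
            (p.eval u.length)) := by
  obtain ⟨K, hK⟩ := hbranch
  have hnG := (SelfSimilar.isLeast_nucleus hcontr).1
  obtain ⟨A, hAfin, hA⟩ := SelfSimilar.exists_finite_closure_eq hK.le hK.finite_index
    ((Subgroup.fg_iff G).2 ⟨S, hgen, hfin⟩)
  obtain ⟨rep, hrep, hdec⟩ := SelfSimilar.exists_mul_representative (G := G) (K := K)
  obtain ⟨E, hE⟩ := SelfSimilar.exists_isCompatible hK hnG.subset hA hgen hrep hdec
  have : (K.subgroupOf G).FiniteIndex := ⟨hK.finite_index⟩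
  have : Finite (SelfSimilar.nucleus G) := hnG.finite
  have : Finite A := hAfin
  have : Finite S := hfin
  let : Inhabited (G ⧸ K.subgroupOf G) := ⟨(1 : G)⟩
  obtain ⟨C, hleaf, hnode, hout⟩ := E.exists_size_bound
  obtain ⟨a, b, hab⟩ := SelfSimilar.exists_logarithmic_level hcontr hfin hgen
  -- `a + 1`, because the exponent in `le_pow` is the depth plus one.
  obtain ⟨q, hq⟩ := SelfSimilar.exists_pow_clog_le ((C + 1) * (d + 1)) (a + 1) b
  -- `C` bounds the output length in terms of the size, and `7` absorbs the constants of the running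
  -- time.
  refine ⟨⟨E.machine, .refl _, .refl _⟩, Polynomial.C (C + 7) * (q + 1), fun g => ?_⟩
  have hP := SelfSimilar.nucleusPortrait_spec hcontr g
  -- The output depends only on the portrait, so the bounds below hold for every word `u` that
  -- represents `g`.
  refine ⟨E.output (SelfSimilar.nucleusPortrait hcontr g), hE.eval_output hK.le hself hP g.2,
    fun u hu => ?_⟩
  have hsize : E.size (SelfSimilar.nucleusPortrait hcontr g) ≤ q.eval u.length := by
    refine (hP.le_pow hleaf hnode _ (hu ▸ hab u)).trans (le_trans (le_of_eq ?_) (hq u.length))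
    ring
  simp only [Polynomial.eval_mul, Polynomial.eval_C, Polynomial.eval_add, Polynomial.eval_one]
  constructor
  · exact (hout _).trans (Nat.mul_le_mul (by omega) (by omega))
  · have hlen := E.length_encode_le_cost (SelfSimilar.nucleusPortrait hcontr g)
    have h := E.outputsInTime_machine (SelfSimilar.nucleusPortrait hcontr g)
      (n := (C + 7) * (q.eval u.length + 1)) (by
        rw [PortraitEvaluator.size] at hsize
        nlinarith [Nat.zero_le (C * (q.eval u.length + 1))])
    have e₁ : ∀ l : List (SelfSimilar.PortraitSymbol d (SelfSimilar.nucleus G)),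
        l.map (Equiv.refl _).symm = l := fun l => List.map_id l
    have e₂ : ∀ l : SelfSimilar.GenWord S, l.map (Equiv.refl _).symm = l := fun l => List.map_id l
    exact (congrArg₂ (fun x y => Nonempty (Turing.TM2OutputsInTime E.machine x (some y) _))
      (e₁ _) (e₂ _)).mpr h
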